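/- Setting. Let $n>2$ and let $Ty_n$ be classical extensional higher-order logic (axiomatized as Andrews' $Q_0$ with descriptions) with truth type $t$, individual types $e_1,\dots,e_n$, functional types $(\alpha\beta)$ (functions from $\alpha$ to $\beta$; association to the right) and product types $\alpha\times\beta$ with pairing and projections $\pi_1,\pi_2$. Put $s=e_n$, $c=e_{n-1}$ and $\bar\alpha=c(c\times\alpha)$; objects of type $\bar\alpha$ are identified with pairs of objects of types $cc$ and $c\alpha$ (namely $z_{\bar\alpha}$ with $\lambda x_c\,\pi_1(z\,x_c)$ and $\lambda x_c\,\pi_2(z\,x_c)$), and accordingly $\bar\alpha t$ with $(cc)(c\alpha)t$. Let $\mathcal A=\{a_1,\dots,a_N\}$ be a finite alphabet. $Ty_n^{\mathcal A}$ has constants $C^0_s,C^1_s,\dots,C^N_s$, $C^0_{sss}$ (written $+$), possibly further constants, and the axioms: $x_s+C^0_s=x_s$ and $C^0_s+x_s=x_s$; $(x_s+y_s)+z_s=x_s+(y_s+z_s)$; $x_s+C^i_s+y_s\neq x_s+C^j_s+z_s$ for $1\le i<j\le N$ (universally quantified). $Ty_n^{\mathcal A+}$ is an extension of $Ty_n^{\mathcal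 A}$ by additional non-logical constants. For a word $w\in\mathcal A^*$ the term $T_A(w)$ is given by $T_A(\epsilon)=C^0_s$, $T_A(a_i)=C^i_s$, $T_A(a_iw)=C^i_s+T_A(w)$ for $w\ne\epsilon$. An $\alpha$-language is a set $\mathcal L$ of pairs $(w,A_\alpha)$ of a word $w\in\mathcal A^*$ and a $Ty_n^{\mathcal A}$ term $A_\alpha$ (terms may have free variables). It is represented by $(\Delta,L_{s\alpha t})$, where $\Delta$ is a consistent set of $Ty_n^{\mathcal A+}$ formulas and $L_{s\alpha t}$ a $Ty_n^{\mathcal A+}$ term, if for all words $w$ and $Ty_n^{\mathcal A}$ terms $A_\alpha$ $$(w,A_\alpha)\in\mathcal L\iff\Delta\vdash L_{s\alpha t}\,T_A(w)\,A_\alpha .$$ The representation $(\Delta,L_{s\alpha t})$ is pseudo-canonic if moreover (i) for every word $w$ there is a finite, possibly empty, list of $Ty_n^{\mathcal A}$ terms $A^1_\alpha,\dots,A^l_\alpha$ with $\Delta\vdash L_{s\alpha t}\,T_A(w)=\lambda x_\alpha\,(x_\alpha=A^1_\alpha\vee\dots\vee x_\alpha=A^l_\alpha)$, where $x_\alpha$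 is not free in the $A^i_\alpha$ and the empty disjunction is falsity, and (ii) for every $Ty_n^{\mathcal A}$ formula $A_t$, $\vdash A_t$ in $Ty_n^{\mathcal A}$ iff $\Delta\vdash A_t$ in $Ty_n^{\mathcal A+}$. For an $\alpha$-language $\mathcal L$ and a $Ty_n^{\mathcal A}$ term $F_{\alpha cc}$ the context raising $\mathcal L\uparrow F_{\alpha cc}$ is the $\bar\alpha$-language of all pairs $(w,B_{\bar\alpha})$ for which there is a $Ty_n^{\mathcal A}$ term $A_\alpha$ with $(w,A_\alpha)\in\mathcal L$ and $\vdash CR(F_{\alpha cc})\,A_\alpha\,B_{\bar\alpha}$, where $$CR(F_{\alpha cc})=\lambda x_\alpha\lambda x_{cc}\lambda x_{c\alpha}\,(x_{cc}=F_{\alpha cc}\,x_\alpha\ \wedge\ x_{c\alpha}=\lambda x_c\,x_\alpha)$$ (the variables bound here are pairwise distinct and not free in $F_{\alpha cc}$). Proposition 9.4. If an $\alpha$-language $\mathcal L$ has a pseudo-canonic representation $(\Delta,L_{s\alpha t})$ and $F_{\alpha cc}$ is a $Ty_n^{\mathcal A}$ term, then $\mathcal L\uparrow F_{\alpha cc}$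 has the pseudo-canonic representation $(\Delta,\;L_{s\alpha t}\uparrow F_{\alpha cc})$, where $L_{s\alpha t}\uparrow F_{\alpha cc}$ is the application to $L_{s\alpha t}$ and $F_{\alpha cc}$ of the $Ty_n^{\mathcal A}$ operator $$(\uparrow)=\lambda z_{s\alpha t}\,\lambda z_{\alpha cc}\,\lambda x_s\,\lambda x_{cc}\,\lambda x_{c\alpha}\,\exists x_\alpha\,\bigl(z_{s\alpha t}\,x_s\,x_\alpha\ \wedge\ x_{cc}=z_{\alpha cc}\,x_\alpha\ \wedge\ x_{c\alpha}=\lambda x_c\,x_\alpha\bigr)$$ (with pairwise distinct bound variables). -/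

import Mathlib

universe u v

/-! ## The sorted type theory `Ty_n` with products

Terms are taken up to renaming of bound variables: bound variables are de Bruijn indices, free
variables are named `x^i_α` with `i : ℕ`.  `Tm K Γ α` is the type of terms of type `α` over the
non-logical constants `K` with dangling bound variables of the types listed in `Γ`; the terms of
the theory are those with `Γ = []`. -/

namespace TyN

/-- Types: the truth type `t`, the individual types `e_1, …, e_n`, functional types `(αβ)` and
product types `α × β`. -/
inductive Ty (n : ℕ) : Type
  | t : Ty n
  | e : Fin n → Ty n
  | fn : Ty n → Ty n → Ty n
  | prod : Ty n → Ty n → Ty n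

/-- The functional type from the left type to the right type. -/
infixr:60 " ⇒ₜ " => Ty.fn

/-- The product type. -/
infixr:65 " ×ₜ " => Ty.prod

/-- Positions of type `α` in a list of types. -/
inductive Idx {n : ℕ} : List (Ty n) → Ty n → Type
  | zero {Γ : List (Ty n)} {α : Ty n} : Idx (α :: Γ) α
  | succ {Γ : List (Ty n)} {α β : Ty n} : Idx Γ α → Idx (β :: Γ) α

/-- Terms. `fvar i` at type `α` is the variable `x^i_α`; `const` is a non-logical constant;
`iota` is the description operator of type `(αt)α`. -/
inductive Tm {n : ℕ} (K : Ty n → Type u) : List (Ty n) → Ty n → Type u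
  | bvar {Γ : List (Ty n)} {α : Ty n} : Idx Γ α → Tm K Γ α
  | fvar {Γ : List (Ty n)} {α : Ty n} : ℕ → Tm K Γ α
  | const {Γ : List (Ty n)} {α : Ty n} : K α → Tm K Γ α
  | iota {Γ : List (Ty n)} {α : Ty n} : Tm K Γ ((α ⇒ₜ Ty.t) ⇒ₜ α)
  | app {Γ : List (Ty n)} {α β : Ty n} : Tm K Γ (α ⇒ₜ β) → Tm K Γ α → Tm K Γ β
  | lam {Γ : List (Ty n)} {α β : Ty n} : Tm K (α :: Γ) β → Tm K Γ (α ⇒ₜ β)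
  | eq {Γ : List (Ty n)} {α : Ty n} : Tm K Γ α → Tm K Γ α → Tm K Γ Ty.t
  | pair {Γ : List (Ty n)} {α β : Ty n} : Tm K Γ α → Tm K Γ β → Tm K Γ (α ×ₜ β)
  | fst {Γ : List (Ty n)} {α β : Ty n} : Tm K Γ (α ×ₜ β) → Tm K Γ α
  | snd {Γ : List (Ty n)} {α β : Ty n} : Tm K Γ (α ×ₜ β) → Tm K Γ β

section Terms

variable {n : ℕ} {K : Ty n → Type u} {Γ Θ : List (Ty n)} {α β γ : Ty n}

/-- Extension of a renaming under a binder. -/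
def liftRen (ρ : ∀ α : Ty n, Idx Γ α → Idx Θ α) (β : Ty n) :
    ∀ α : Ty n, Idx (β :: Γ) α → Idx (β :: Θ) α
  | _, Idx.zero => Idx.zero
  | _, Idx.succ i => Idx.succ (ρ _ i)

/-- Renaming of dangling bound variables. -/
def Tm.rename : {Γ Θ : List (Ty n)} → {α : Ty n} →
    (∀ α : Ty n, Idx Γ α → Idx Θ α) → Tm K Γ α → Tm K Θ α
  | _, _, _, ρ, .bvar i => .bvar (ρ _ i)
  | _, _, _, _, .fvar i => .fvar i
  | _, _, _, _, .const k => .const k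
  | _, _, _, _, .iota => .iota
  | _, _, _, ρ, .app A B => .app (A.rename ρ) (B.rename ρ)
  | _, _, _, ρ, .lam A => .lam (A.rename (liftRen ρ _))
  | _, _, _, ρ, .eq A B => .eq (A.rename ρ) (B.rename ρ)
  | _, _, _, ρ, .pair A B => .pair (A.rename ρ) (B.rename ρ)
  | _, _, _, ρ, .fst A => .fst (A.rename ρ)
  | _, _, _, ρ, .snd A => .snd (A.rename ρ)

/-- Weakening: the same term placed under one more binder, which does not bind anything in it. -/
def Tm.wk (A : Tm K Γ α) : Tm K (β :: Γ) α := A.rename (fun _ i => Idx.succ i)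

/-- A term without dangling bound variables placed under any binders. -/
def Tm.wkAll (A : Tm K [] α) : Tm K Γ α := A.rename (fun _ i => by cases i)

/-- Extension of a substitution under a binder. -/
def liftSub (σ : ∀ α : Ty n, Idx Γ α → Tm K Θ α) (β : Ty n) :
    ∀ α : Ty n, Idx (β :: Γ) α → Tm K (β :: Θ) α
  | _, Idx.zero => .bvar Idx.zero
  | _, Idx.succ i => (σ _ i).wk

/-- Capture-avoiding simultaneous substitution for dangling bound variables. -/
def Tm.subst : {Γ Θ : List (Ty n)} → {α : Ty n} →
    (∀ α : Ty n, Idx Γ α → Tm K Θ α) → Tm K Γ α → Tm K Θ α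
  | _, _, _, σ, .bvar i => σ _ i
  | _, _, _, _, .fvar i => .fvar i
  | _, _, _, _, .const k => .const k
  | _, _, _, _, .iota => .iota
  | _, _, _, σ, .app A B => .app (A.subst σ) (B.subst σ)
  | _, _, _, σ, .lam A => .lam (A.subst (liftSub σ _))
  | _, _, _, σ, .eq A B => .eq (A.subst σ) (B.subst σ)
  | _, _, _, σ, .pair A B => .pair (A.subst σ) (B.subst σ)
  | _, _, _, σ, .fst A => .fst (A.subst σ)
  | _, _, _, σ, .snd A => .snd (A.subst σ)

/-- The substitution of `B` for the innermost dangling variable. -/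
def instSub (B : Tm K Γ β) : ∀ α : Ty n, Idx (β :: Γ) α → Tm K Γ α
  | _, Idx.zero => B
  | _, Idx.succ i => .bvar i

/-- `A.inst B`: the body `A` of an abstraction with its bound variable replaced by `B`. -/
def Tm.inst (A : Tm K (β :: Γ) α) (B : Tm K Γ β) : Tm K Γ α := A.subst (instSub B)

/-- Translation of terms along a map of non-logical constants. -/
def Tm.mapConst {K' : Ty n → Type v} (f : ∀ α : Ty n, K α → K' α) :
    {Γ : List (Ty n)} → {α : Ty n} → Tm K Γ α → Tm K' Γ α
  | _, _, .bvar i => .bvar i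
  | _, _, .fvar i => .fvar i
  | _, _, .const k => .const (f _ k)
  | _, _, .iota => .iota
  | _, _, .app A B => .app (A.mapConst f) (B.mapConst f)
  | _, _, .lam A => .lam (A.mapConst f)
  | _, _, .eq A B => .eq (A.mapConst f) (B.mapConst f)
  | _, _, .pair A B => .pair (A.mapConst f) (B.mapConst f)
  | _, _, .fst A => .fst (A.mapConst f)
  | _, _, .snd A => .snd (A.mapConst f)

/-- The innermost bound variable. -/
abbrev b0 : Tm K (α :: Γ) α := .bvar .zero

/-- The second innermost bound variable. -/
abbrev b1 : Tm K (β :: α :: Γ) α := .bvar (.succ .zero)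

/-- The third innermost bound variable. -/
abbrev b2 : Tm K (γ :: β :: α :: Γ) α := .bvar (.succ (.succ .zero))

/-! ### Connectives and quantifiers, defined from equality as in `Q₀` -/

/-- Truth: `(=) = (=)` at type `t`. -/
def tt : Tm K Γ Ty.t :=
  .eq (.lam (.lam (.eq (b1 : Tm K (Ty.t :: Ty.t :: Γ) Ty.t) b0)))
    (.lam (.lam (.eq (b1 : Tm K (Ty.t :: Ty.t :: Γ) Ty.t) b0)))

/-- Falsity: `λ x_t T = λ x_t x_t`. -/
def ff : Tm K Γ Ty.t := .eq (.lam (α := Ty.t) tt) (.lam b0)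

/-- `∀ x_α A`: `λ x_α T = λ x_α A`. -/
def all (A : Tm K (α :: Γ) Ty.t) : Tm K Γ Ty.t := .eq (.lam tt) (.lam A)

/-- Conjunction as a term: `λ x_t λ y_t (λ g (g T T) = λ g (g x y))`. -/
def andC : Tm K Γ (Ty.t ⇒ₜ Ty.t ⇒ₜ Ty.t) :=
  .lam (.lam (.eq
    (.lam (.app (.app (b0 : Tm K _ (Ty.t ⇒ₜ Ty.t ⇒ₜ Ty.t)) tt) tt))
    (.lam (.app (.app (b0 : Tm K _ (Ty.t ⇒ₜ Ty.t ⇒ₜ Ty.t)) b2) b1))))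

/-- Conjunction. -/
def and (A B : Tm K Γ Ty.t) : Tm K Γ Ty.t := .app (.app andC A) B

/-- Implication as a term: `λ x_t λ y_t (x = (x ∧ y))`. -/
def impC : Tm K Γ (Ty.t ⇒ₜ Ty.t ⇒ₜ Ty.t) := .lam (.lam (.eq b1 (and b1 b0)))

/-- Implication. -/
def imp (A B : Tm K Γ Ty.t) : Tm K Γ Ty.t := .app (.app impC A) B

/-- Negation: `F = A`. -/
def not (A : Tm K Γ Ty.t) : Tm K Γ Ty.t := .eq ff A

/-- Disjunction as a term: `λ x_t λ y_t ¬ (¬ x ∧ ¬ y)`. -/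
def orC : Tm K Γ (Ty.t ⇒ₜ Ty.t ⇒ₜ Ty.t) := .lam (.lam (not (and (not b1) (not b0))))

/-- Disjunction. -/
def or (A B : Tm K Γ Ty.t) : Tm K Γ Ty.t := .app (.app orC A) B

/-- `∃ x_α A`: `¬ ∀ x_α ¬ A`. -/
def ex (A : Tm K (α :: Γ) Ty.t) : Tm K Γ Ty.t := not (all (not A))

/-- The section `(= B)`: `λ x_α (x_α = B)`. -/
def eqTo (B : Tm K Γ α) : Tm K Γ (α ⇒ₜ Ty.t) := .lam (.eq b0 B.wk)

/-- Disjunction of predicates: `λ x_α (A x_α ∨ B x_α)`. -/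
def orPred (A B : Tm K Γ (α ⇒ₜ Ty.t)) : Tm K Γ (α ⇒ₜ Ty.t) :=
  .lam (or (.app A.wk b0) (.app B.wk b0))

/-- Product of predicates: `λ x_α λ x_β (A x_α ∧ B x_β)`. -/
def prodPred (A : Tm K Γ (α ⇒ₜ Ty.t)) (B : Tm K Γ (β ⇒ₜ Ty.t)) :
    Tm K Γ (α ⇒ₜ β ⇒ₜ Ty.t) :=
  .lam (.lam (and (.app A.wk.wk b1) (.app B.wk.wk b0)))

/-- The predicate `(= A¹) ∨ … ∨ (= Aˡ)`, which is `λ x_α F` for the empty list. -/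
def bigOrEq : List (Tm K Γ α) → Tm K Γ (α ⇒ₜ Ty.t)
  | [] => .lam ff
  | A :: l => orPred (eqTo A) (bigOrEq l)

end Terms

/-! ### Provability -/

/-- The theorems of the theory with non-logical axioms `Ax` (formulas without dangling
variables), in the axiomatization `Q₀` with descriptions, generalized to many sorts and to
products. The theorems with dangling variables `Γ` are derived simultaneously, so that a rule can
be applied under binders; rule R (replacement of equals by equals at any place of a theorem)
is given by `eqMP` together with the congruence rules. -/
inductive Thm {n : ℕ} {K : Ty n → Type u} (Ax : Set (Tm K [] Ty.t)) :
    {Γ : List (Ty n)} → Tm K Γ Ty.t → Prop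
  /-- a non-logical axiom -/
  | ax {Γ : List (Ty n)} {A : Tm K [] Ty.t} : A ∈ Ax → Thm Ax (A.wkAll : Tm K Γ Ty.t)
  /-- `(g T ∧ g F) = ∀ x_t (g x)` -/
  | bool {Γ : List (Ty n)} (g : Tm K Γ (Ty.t ⇒ₜ Ty.t)) :
      Thm Ax (.eq (and (.app g tt) (.app g ff)) (all (.app g.wk b0)))
  /-- `A = B → (h A = h B)` -/
  | leibniz {Γ : List (Ty n)} {α : Ty n} (A B : Tm K Γ α) (h : Tm K Γ (α ⇒ₜ Ty.t)) :
      Thm Ax (imp (.eq A B) (.eq (.app h A) (.app h B)))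
  /-- `(f = g) = ∀ x_α (f x = g x)` -/
  | funext {Γ : List (Ty n)} {α β : Ty n} (f g : Tm K Γ (α ⇒ₜ β)) :
      Thm Ax (.eq (.eq f g) (all (.eq (.app f.wk b0) (.app g.wk b0))))
  /-- `(λ x A) B = A(B)` -/
  | beta {Γ : List (Ty n)} {α β : Ty n} (A : Tm K (α :: Γ) β) (B : Tm K Γ α) :
      Thm Ax (.eq (.app (.lam A) B) (A.inst B))
  /-- `ι (λ x (A = x)) = A` -/
  | descr {Γ : List (Ty n)} {α : Ty n} (A : Tm K Γ α) :
      Thm Ax (.eq (.app .iota (.lam (.eq A.wk b0))) A)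
  /-- `π₁ (A, B) = A` -/
  | fst_pair {Γ : List (Ty n)} {α β : Ty n} (A : Tm K Γ α) (B : Tm K Γ β) :
      Thm Ax (.eq (.fst (.pair A B)) A)
  /-- `π₂ (A, B) = B` -/
  | snd_pair {Γ : List (Ty n)} {α β : Ty n} (A : Tm K Γ α) (B : Tm K Γ β) :
      Thm Ax (.eq (.snd (.pair A B)) B)
  /-- `(π₁ A, π₂ A) = A` -/
  | pair_eta {Γ : List (Ty n)} {α β : Ty n} (A : Tm K Γ (α ×ₜ β)) :
      Thm Ax (.eq (.pair (.fst A) (.snd A)) A)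
  | eqMP {Γ : List (Ty n)} {A B : Tm K Γ Ty.t} : Thm Ax (.eq A B) → Thm Ax A → Thm Ax B
  | refl {Γ : List (Ty n)} {α : Ty n} (A : Tm K Γ α) : Thm Ax (.eq A A)
  | congApp {Γ : List (Ty n)} {α β : Ty n} {A A' : Tm K Γ (α ⇒ₜ β)} {B B' : Tm K Γ α} :
      Thm Ax (.eq A A') → Thm Ax (.eq B B') → Thm Ax (.eq (.app A B) (.app A' B'))
  | congLam {Γ : List (Ty n)} {α β : Ty n} {A A' : Tm K (α :: Γ) β} :
      Thm Ax (.eq A A') → Thm Ax (.eq (.lam A) (.lam A'))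
  | congEq {Γ : List (Ty n)} {α : Ty n} {A A' B B' : Tm K Γ α} :
      Thm Ax (.eq A A') → Thm Ax (.eq B B') → Thm Ax (.eq (.eq A B) (.eq A' B'))
  | congPair {Γ : List (Ty n)} {α β : Ty n} {A A' : Tm K Γ α} {B B' : Tm K Γ β} :
      Thm Ax (.eq A A') → Thm Ax (.eq B B') → Thm Ax (.eq (.pair A B) (.pair A' B'))
  | congFst {Γ : List (Ty n)} {α β : Ty n} {A A' : Tm K Γ (α ×ₜ β)} :
      Thm Ax (.eq A A') → Thm Ax (.eq (.fst A) (.fst A'))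
  | congSnd {Γ : List (Ty n)} {α β : Ty n} {A A' : Tm K Γ (α ×ₜ β)} :
      Thm Ax (.eq A A') → Thm Ax (.eq (.snd A) (.snd A'))

/-- `Δ ⊢ A` in the theory with non-logical axioms `Ax`: derivability from theorems and from the
hypotheses `Δ` by modus ponens. The free variables of the hypotheses are held fixed, so that the
Deduction Theorem holds. -/
inductive Derives {n : ℕ} {K : Ty n → Type u} (Ax Δ : Set (Tm K [] Ty.t)) : Tm K [] Ty.t → Prop
  | hyp {A : Tm K [] Ty.t} : A ∈ Δ → Derives Ax Δ A
  | thm {A : Tm K [] Ty.t} : Thm Ax A → Derives Ax Δ A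
  | mp {A B : Tm K [] Ty.t} : Derives Ax Δ (imp A B) → Derives Ax Δ A → Derives Ax Δ B

/-! ## The extension `Ty_n^𝒜` by a symbolic type, with a context type -/

section Symbolic

variable {n : ℕ} [hn : Fact (2 < n)]

/-- The symbolic type `s = e_n`. -/
def sTy : Ty n := .e ⟨n - 1, by have := hn.out; omega⟩

/-- The context type `c = e_{n-1}`. -/
def cTy : Ty n := .e ⟨n - 2, by have := hn.out; omega⟩

/-- The type `c(c × α)` of the meanings of a context-dependent `α`-language. -/
abbrev ctxTy (α : Ty n) : Ty n := cTy ⇒ₜ (cTy ×ₜ α)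

/-- The non-logical constants of `Ty_n^𝒜` for the alphabet `a_1, …, a_N`: the empty word `C⁰_s`,
the letters `C¹_s, …, Cᴺ_s`, the concatenation `C⁰_{sss}`, and arbitrary other constants `S`. -/
inductive SymConst (N : ℕ) (S : Ty n → Type u) : Ty n → Type u
  | eps : SymConst N S sTy
  | letter : Fin N → SymConst N S sTy
  | concat : SymConst N S (sTy ⇒ₜ sTy ⇒ₜ sTy)
  | other {α : Ty n} : S α → SymConst N S α

/-- The terms of `Ty_n^𝒜`. -/
abbrev STm (N : ℕ) (S : Ty n → Type u) (α : Ty n) : Type u := Tm (SymConst N S) [] α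

variable {N : ℕ} {S : Ty n → Type u} {Γ : List (Ty n)} {α β : Ty n}

/-- `C⁰_s`. -/
def epsT : Tm (SymConst N S) Γ sTy := .const .eps

/-- `Cⁱ_s`. -/
def letT (i : Fin N) : Tm (SymConst N S) Γ sTy := .const (.letter i)

/-- `A + B`. -/
def cat (A B : Tm (SymConst N S) Γ sTy) : Tm (SymConst N S) Γ sTy :=
  .app (.app (.const .concat) A) B

variable (N S) in
/-- The non-logical axioms of `Ty_n^𝒜`: `C⁰_s` is neutral, concatenation is associative, and
`x + Cⁱ + y ≠ x + Cʲ + z` for `i < j`. -/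
inductive SymAx : Tm (SymConst N S) [] Ty.t → Prop
  | unit : SymAx (all (and (.eq (cat b0 epsT) b0) (.eq (cat epsT b0) b0)))
  | assoc : SymAx (all (all (all (.eq (cat (cat b2 b1) b0) (cat b2 (cat b1 b0))))))
  | sep (i j : Fin N) : i < j →
      SymAx (all (all (all (not
        (.eq (cat (cat b2 (letT i)) b1) (cat (cat b2 (letT j)) b0))))))

/-- `⊢ A` in `Ty_n^𝒜`. -/
def SProv (A : STm N S Ty.t) : Prop := Thm {B | SymAx N S B} A

/-- `Δ ⊢ A` in `Ty_n^𝒜`. -/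
def SDerives (Δ : Set (STm N S Ty.t)) (A : STm N S Ty.t) : Prop := Derives {B | SymAx N S B} Δ A

/-- The term `T_A(w)` denoting the word `w`. -/
def wordT : List (Fin N) → STm N S sTy
  | [] => epsT
  | [i] => letT i
  | i :: j :: w => cat (letT i) (wordT (j :: w))

/-- Inclusion of the constants of `Ty_n^𝒜` in those of its extension by the constants `E`. -/
def inclConst (E : Ty n → Type v) :
    ∀ α : Ty n, SymConst N S α → SymConst N (fun α => S α ⊕ E α) α
  | _, .eps => .eps
  | _, .letter i => .letter i
  | _, .concat => .concat
  | _, .other k => .other (.inl k)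

/-- A term of `Ty_n^𝒜` as a term of its extension by the constants `E`. -/
def incl (E : Ty n → Type v) (A : STm N S α) : STm N (fun α => S α ⊕ E α) α :=
  A.mapConst (inclConst E)

/-! ### Languages and rules -/

/-- `α`-languages: relations between words and `α`-terms. -/
abbrev ALang (N : ℕ) (S : Ty n → Type u) (α : Ty n) : Type u := Set (List (Fin N) × STm N S α)

/-- Semantic rules: relations between `α`-terms and `β`-terms. -/
abbrev SemRule (N : ℕ) (S : Ty n → Type u) (α β : Ty n) : Type u :=
  Set (STm N S α × STm N S β)

/-- Application of a semantic rule to a language. -/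
def applyRule (L : ALang N S α) (R : SemRule N S α β) : ALang N S β :=
  {p | ∃ A : STm N S α, (p.1, A) ∈ L ∧ (A, p.2) ∈ R}

/-- The semantic rule represented by a term `R` of type `αβt`. -/
def ruleOf (R : STm N S (α ⇒ₜ β ⇒ₜ Ty.t)) : SemRule N S α β :=
  {p | SProv (.app (.app R p.1) p.2)}

/-- The identification of `(cc)(cα)t` with `c(c × α)t`: a relation between `cc`- and `cα`-objects
as the predicate `λ z (R (λ x_c π₁ (z x_c)) (λ x_c π₂ (z x_c)))` on `c(c × α)`-objects. -/
def uncur (R : Tm (SymConst N S) Γ ((cTy ⇒ₜ cTy) ⇒ₜ (cTy ⇒ₜ α) ⇒ₜ Ty.t)) :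
    Tm (SymConst N S) Γ (ctxTy α ⇒ₜ Ty.t) :=
  .lam (.app (.app R.wk (.lam (.fst (.app b1 b0)))) (.lam (.snd (.app b1 b0))))

/-- The context raising term `λ x_α ((= F x_α) × (= λ x_c x_α))`. -/
def raiseRuleT (F : STm N S (α ⇒ₜ cTy ⇒ₜ cTy)) : STm N S (α ⇒ₜ ctxTy α ⇒ₜ Ty.t) :=
  .lam (uncur (prodPred (eqTo (.app F.wk b0)) (eqTo (.lam b1))))

/-- Context raising `ℒ ↑ F` of an `α`-language. -/
def raise (L : ALang N S α) (F : STm N S (α ⇒ₜ cTy ⇒ₜ cTy)) : ALang N S (ctxTy α) :=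
  applyRule L (ruleOf (raiseRuleT F))

/-- The operator `↑`:
`λ z_{sαt} λ z_{αcc} λ x_s λ x_{cc} λ x_{cα} ∃ x_α
(z_{sαt} x_s x_α ∧ x_{cc} = z_{αcc} x_α ∧ x_{cα} = λ x_c x_α)`. -/
def upT : Tm (SymConst N S) Γ
    ((sTy ⇒ₜ α ⇒ₜ Ty.t) ⇒ₜ (α ⇒ₜ cTy ⇒ₜ cTy) ⇒ₜ sTy ⇒ₜ ctxTy α ⇒ₜ Ty.t) :=
  .lam (.lam (.lam (uncur (.lam (.lam (ex
    (and (.app (.app (.bvar (.succ (.succ (.succ (.succ (.succ .zero)))))) (.bvar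
        (.succ (.succ (.succ .zero))))) b0)
      (and (.eq b2 (.app (.bvar (.succ (.succ (.succ (.succ .zero))))) b0))
        (.eq b1 (.lam b1))))))))))

/-! ### Representations -/

/-- The `α`-language `ℒ` is represented by `(Δ, L)`, where `Δ` is a consistent set of formulas and
`L` a term of the extension of `Ty_n^𝒜` by the constants `E`. -/
structure Represents (E : Ty n → Type v) (Δ : Set (STm N (fun α => S α ⊕ E α) Ty.t))
    (L : STm N (fun α => S α ⊕ E α) (sTy ⇒ₜ α ⇒ₜ Ty.t)) (ℒ : ALang N S α) : Prop where
  consistent : ¬ SDerives Δ ff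
  mem_iff : ∀ (w : List (Fin N)) (A : STm N S α),
    (w, A) ∈ ℒ ↔ SDerives Δ (.app (.app L (wordT w)) (incl E A))

/-- `(Δ, L)` is a pseudo-canonic representation of the `α`-language `ℒ`. -/
structure PseudoCanonic (E : Ty n → Type v) (Δ : Set (STm N (fun α => S α ⊕ E α) Ty.t))
    (L : STm N (fun α => S α ⊕ E α) (sTy ⇒ₜ α ⇒ₜ Ty.t)) (ℒ : ALang N S α) : Prop
    extends Represents E Δ L ℒ where
  finite_meanings : ∀ w : List (Fin N), ∃ l : List (STm N S α),
    SDerives Δ (.eq (.app L (wordT w)) (bigOrEq (l.map (incl E))))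
  conservative : ∀ A : STm N S Ty.t, SProv A ↔ SDerives Δ (incl E A)

end Symbolic

end TyN

/-! Raising sends an object `A` to the single object `raiseT F A`, the function `λ x_c (F A x_c,
A)`. A function into a product is determined by its two component functions, so "the components of
`X` are `F A` and the constant function `A`" is provably the same as `X = raiseT F A`
(`raiseRel_eq`). By β and η, the raised language term at a word `w` is the predicate `∃ x (L w x ∧ X
= raiseT F x)`, in the form `raisePred` (`upT_app`).

If `L w` is a finite disjunction of equations `x = Aⁱ`, the existential distributes over it. The
one-point rule then leaves the disjunction of the `X = raiseT F Aⁱ` (`raisePred_bigOrEq`), which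
gives the finite list of meanings.

In the membership equivalence, one direction is existential introduction. The other needs a witness
that is a term of the base theory, although the derivable existential lives in the extension and
need not supply one. Raising is injective in a definable way: the raised object has `A` as its
second component in every context, so `π₂ (B x_c)` is such a witness (`raiseEx_imp`). Conservativity
of `Δ` moves the rule's provability between the two theories. Consistency and conservativity concern
`Δ` alone and carry over.

The remaining work is to derive propositional and quantifier logic from equality. All reasoning
under assumptions is phrased as provable implications between formulas with dangling variables, so
derivations from `Δ` only need modus ponens with theorems and conjunction introduction. -/

namespace TyN

/-! ### Renaming and substitution of de Bruijn terms. -/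

section Substitution

variable {n : ℕ} {K : Ty n → Type u} {Γ Θ Ξ : List (Ty n)} {α β γ : Ty n}

@[simp] theorem liftSub_bvar :
    liftSub (fun α (i : Idx Γ α) => (Tm.bvar i : Tm K Γ α)) β = fun _ i => .bvar i := by
  funext α i; cases i <;> rfl

theorem Tm.rename_rename (A : Tm K Γ α) {Θ Ξ : List (Ty n)} (ρ : ∀ α, Idx Γ α → Idx Θ α)
    (ρ' : ∀ α, Idx Θ α → Idx Ξ α) :
    (A.rename ρ).rename ρ' = A.rename (fun α i => ρ' α (ρ α i)) := by
  induction A generalizing Θ Ξ with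
  | lam A ih =>
    simp only [Tm.rename, ih]
    congr 2
    funext α i; cases i <;> rfl
  | _ => simp_all only [Tm.rename]

theorem Tm.rename_subst (A : Tm K Γ α) {Θ Ξ : List (Ty n)} (ρ : ∀ α, Idx Γ α → Idx Θ α)
    (σ : ∀ α, Idx Θ α → Tm K Ξ α) :
    (A.rename ρ).subst σ = A.subst (fun α i => σ α (ρ α i)) := by
  induction A generalizing Θ Ξ with
  | lam A ih =>
    simp only [Tm.rename, Tm.subst, ih]
    congr 2
    funext α i; cases i <;> rfl
  | _ => simp_all only [Tm.rename, Tm.subst]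

theorem Tm.wk_rename_liftRen (A : Tm K Γ α) (ρ : ∀ α, Idx Γ α → Idx Θ α) :
    (A.wk (β := β)).rename (liftRen ρ β) = (A.rename ρ).wk := by
  simp only [Tm.wk, Tm.rename_rename]; rfl

theorem Tm.subst_rename (A : Tm K Γ α) {Θ Ξ : List (Ty n)} (σ : ∀ α, Idx Γ α → Tm K Θ α)
    (ρ : ∀ α, Idx Θ α → Idx Ξ α) :
    (A.subst σ).rename ρ = A.subst (fun α i => (σ α i).rename ρ) := by
  induction A generalizing Θ Ξ with
  | lam A ih =>
    simp only [Tm.rename, Tm.subst, ih]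
    congr 2
    funext α i; cases i
    · rfl
    · exact Tm.wk_rename_liftRen _ _
  | _ => simp_all only [Tm.rename, Tm.subst]

@[simp] theorem Tm.subst_bvar (A : Tm K Γ α) : A.subst (fun _ i => .bvar i) = A := by
  induction A with
  | lam A ih => simp only [Tm.subst, liftSub_bvar, ih]
  | _ => simp_all only [Tm.subst]

@[simp] theorem Tm.wk_subst_liftSub (A : Tm K Γ α) (σ : ∀ α, Idx Γ α → Tm K Θ α) :
    (A.wk (β := β)).subst (liftSub σ β) = (A.subst σ).wk := by
  simp only [Tm.wk, Tm.rename_subst, Tm.subst_rename]; rfl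

@[simp] theorem Tm.wk_subst_instSub (A : Tm K Γ α) (B : Tm K Γ β) :
    A.wk.subst (instSub B) = A := by
  simp only [Tm.wk, Tm.rename_subst]; exact A.subst_bvar

/-- This is the renaming of a bound variable: it lets instantiation results be applied to a body at
its own bound variable. -/
theorem Tm.rename_liftRen_inst (A : Tm K (β :: Γ) α) :
    (A.rename (liftRen (fun _ i => Idx.succ i) β)).subst (instSub b0) = A := by
  rw [Tm.rename_subst]
  conv_rhs => rw [← A.subst_bvar]
  congr 1
  funext α i; cases i <;> rfl

theorem Tm.rename_liftRen_subst_liftSub (A : Tm K (β :: Γ) α) (B : Tm K Γ γ) :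
    (A.rename (liftRen (fun _ i => Idx.succ i) β)).subst (liftSub (instSub B) β) = A := by
  rw [Tm.rename_subst]
  conv_rhs => rw [← A.subst_bvar]
  congr 1
  funext α i; cases i <;> rfl

@[simp] theorem liftSub_zero (σ : ∀ α : Ty n, Idx Γ α → Tm K Θ α) :
    liftSub σ β β Idx.zero = .bvar .zero := rfl
@[simp] theorem liftSub_succ (σ : ∀ α : Ty n, Idx Γ α → Tm K Θ α) (i : Idx Γ α) :
    liftSub σ β α (.succ i) = (σ _ i).wk := rfl
@[simp] theorem instSub_zero (B : Tm K Γ β) : instSub B β Idx.zero = B := rfl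
@[simp] theorem liftRen_zero (ρ : ∀ α : Ty n, Idx Γ α → Idx Θ α) :
    liftRen ρ β β Idx.zero = .zero := rfl
@[simp] theorem liftRen_succ (ρ : ∀ α : Ty n, Idx Γ α → Idx Θ α) (i : Idx Γ α) :
    liftRen ρ β α (.succ i) = .succ (ρ _ i) := rfl

attribute [simp] Tm.subst Tm.rename Tm.wk_rename_liftRen Tm.rename_liftRen_inst
  Tm.rename_liftRen_subst_liftSub

@[simp] theorem Tm.rename_succ (A : Tm K Γ α) :
    A.rename (fun _ i => (Idx.succ i : Idx (β :: Γ) _)) = A.wk := rfl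

section Constructors

variable (σ : ∀ α, Idx Γ α → Tm K Θ α) (ρ : ∀ α, Idx Γ α → Idx Θ α)

@[simp] theorem Tm.wk_bvar (i : Idx Γ α) :
    (Tm.bvar i : Tm K Γ α).wk (β := β) = .bvar (.succ i) := rfl
@[simp] theorem Tm.wk_app (A : Tm K Γ (α ⇒ₜ γ)) (B : Tm K Γ α) :
    (Tm.app A B).wk (β := β) = .app A.wk B.wk := rfl
@[simp] theorem Tm.wk_eq (A B : Tm K Γ α) : (Tm.eq A B).wk (β := β) = .eq A.wk B.wk := rfl
@[simp] theorem Tm.wk_snd (A : Tm K Γ (α ×ₜ γ)) : (Tm.snd A).wk (β := β) = .snd A.wk := rfl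
theorem Tm.wk_lam (A : Tm K (α :: Γ) γ) :
    (Tm.lam A).wk (β := β) = .lam (A.rename (liftRen (fun _ i => .succ i) α)) := rfl

@[simp] theorem tt_subst : (tt : Tm K Γ Ty.t).subst σ = tt := rfl
@[simp] theorem tt_wk : (tt : Tm K Γ Ty.t).wk (β := β) = tt := rfl
@[simp] theorem ff_subst : (ff : Tm K Γ Ty.t).subst σ = ff := rfl
@[simp] theorem ff_wk : (ff : Tm K Γ Ty.t).wk (β := β) = ff := rfl

variable (A B : Tm K Γ Ty.t)

@[simp] theorem and_subst : (and A B).subst σ = and (A.subst σ) (B.subst σ) := rfl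
@[simp] theorem and_rename : (and A B).rename ρ = and (A.rename ρ) (B.rename ρ) := rfl
@[simp] theorem and_wk : (and A B).wk (β := β) = and A.wk B.wk := rfl
@[simp] theorem imp_subst : (imp A B).subst σ = imp (A.subst σ) (B.subst σ) := rfl
@[simp] theorem or_subst : (or A B).subst σ = or (A.subst σ) (B.subst σ) := rfl
@[simp] theorem or_rename : (or A B).rename ρ = or (A.rename ρ) (B.rename ρ) := rfl
@[simp] theorem not_subst : (not A).subst σ = not (A.subst σ) := rfl
@[simp] theorem all_subst (P : Tm K (β :: Γ) Ty.t) :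
    (all P).subst σ = all (P.subst (liftSub σ β)) := rfl
@[simp] theorem ex_subst (P : Tm K (β :: Γ) Ty.t) :
    (ex P).subst σ = ex (P.subst (liftSub σ β)) := rfl
@[simp] theorem ex_rename (P : Tm K (β :: Γ) Ty.t) :
    (ex P).rename ρ = ex (P.rename (liftRen ρ β)) := rfl

end Constructors

end Substitution

/-! ### The equational core of `Q₀`: truth values and the rule of cases. -/

section Logic

variable {n : ℕ} {K : Ty n → Type u} {Ax : Set (Tm K [] Ty.t)} {Γ : List (Ty n)} {α β γ : Ty n}

namespace Thm

theorem symm {A B : Tm K Γ α} (h : Thm Ax (.eq A B)) : Thm Ax (.eq B A) :=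
  eqMP (congEq h (refl A)) (refl A)

theorem trans {A B C : Tm K Γ α} (h : Thm Ax (.eq A B)) (h' : Thm Ax (.eq B C)) :
    Thm Ax (.eq A C) :=
  eqMP (congEq (refl A) h') h

theorem eqMPR {A B : Tm K Γ Ty.t} (h : Thm Ax (.eq A B)) (hB : Thm Ax B) : Thm Ax A :=
  eqMP h.symm hB

theorem beta₂ (P : Tm K (β :: α :: Γ) γ) (A : Tm K Γ α) (B : Tm K Γ β) :
    Thm Ax (.eq (.app (.app (.lam (.lam P)) A) B)
      ((P.subst (liftSub (instSub A) β)).subst (instSub B))) :=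
  (congApp (beta _ _) (refl _)).trans (beta _ _)

theorem all_congr {A B : Tm K (α :: Γ) Ty.t} (h : Thm Ax (.eq A B)) :
    Thm Ax (.eq (all A) (all B)) := congEq (refl _) (congLam h)

theorem not_congr {A B : Tm K Γ Ty.t} (h : Thm Ax (.eq A B)) :
    Thm Ax (.eq (not A) (not B)) := congEq (refl _) h

theorem ex_congr {A B : Tm K (α :: Γ) Ty.t} (h : Thm Ax (.eq A B)) :
    Thm Ax (.eq (ex A) (ex B)) := not_congr (all_congr (not_congr h))

theorem and_congr {A A' B B' : Tm K Γ Ty.t} (h : Thm Ax (.eq A A')) (h' : Thm Ax (.eq B B')) :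
    Thm Ax (.eq (and A B) (and A' B')) := congApp (congApp (refl _) h) h'

theorem imp_congr {A A' B B' : Tm K Γ Ty.t} (h : Thm Ax (.eq A A')) (h' : Thm Ax (.eq B B')) :
    Thm Ax (.eq (imp A B) (imp A' B')) := congApp (congApp (refl _) h) h'

theorem or_congr {A A' B B' : Tm K Γ Ty.t} (h : Thm Ax (.eq A A')) (h' : Thm Ax (.eq B B')) :
    Thm Ax (.eq (or A B) (or A' B')) := congApp (congApp (refl _) h) h'

theorem truth : Thm Ax (tt : Tm K Γ Ty.t) := refl _

/-- Instantiation of a universally quantified equation with truth. -/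
theorem inst_of_all {P : Tm K (α :: Γ) Ty.t} (h : Thm Ax (all P)) (A : Tm K Γ α) :
    Thm Ax (.eq tt (P.subst (instSub A))) :=
  ((beta tt A).symm.trans (congApp h (refl A))).trans (beta P A)

theorem all_elim {P : Tm K (α :: Γ) Ty.t} (h : Thm Ax (all P)) (A : Tm K Γ α) :
    Thm Ax (P.subst (instSub A)) := eqMP (inst_of_all h A) truth

/-- Extensionality for the identity function proves `∀ x (x = x)`. As a universal formula is itself
an equation between abstractions, applying both sides to `A` gives an equation with `T`, which at
this stage is more than provability of `A = A`. -/
theorem tt_eq_refl (A : Tm K Γ α) : Thm Ax (.eq tt (.eq A A)) := by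
  have h1 := eqMP (funext (Ax := Ax) (.lam b0 : Tm K Γ (α ⇒ₜ α)) (.lam b0)) (refl _)
  have h2 := inst_of_all h1 A
  simp only [Tm.subst, Tm.wk_subst_instSub, instSub_zero] at h2
  exact h2.trans (congEq (beta b0 A) (beta b0 A))

theorem and_tt_tt : Thm Ax (.eq (and tt tt) (tt : Tm K Γ Ty.t)) := by
  have h := bool (Ax := Ax) (.lam tt : Tm K Γ (Ty.t ⇒ₜ Ty.t))
  refine (and_congr (beta tt tt).symm (beta tt ff).symm).trans (h.trans ?_)
  exact (all_congr (beta _ _)).trans (tt_eq_refl _).symm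

theorem and_intro_eq {A B : Tm K Γ α} {C D : Tm K Γ β} (h : Thm Ax (.eq A B))
    (h' : Thm Ax (.eq C D)) : Thm Ax (and (.eq A B) (.eq C D)) := by
  have h1 : Thm Ax (.eq tt (.eq A B)) := (tt_eq_refl A).trans (congEq (refl _) h)
  have h2 : Thm Ax (.eq tt (.eq C D)) := (tt_eq_refl C).trans (congEq (refl _) h')
  exact eqMP (and_congr h1 h2) (eqMPR and_tt_tt truth)

theorem bool_inst (P : Tm K (Ty.t :: Γ) Ty.t) :
    Thm Ax (.eq (and (P.subst (instSub tt)) (P.subst (instSub ff))) (all P)) := by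
  have h := bool (Ax := Ax) (.lam P)
  refine (and_congr (beta P tt).symm (beta P ff).symm).trans (h.trans (all_congr ?_))
  have := beta (Ax := Ax) (P.rename (liftRen (fun _ i => Idx.succ i) Ty.t)) b0
  simp only [Tm.inst, Tm.rename_liftRen_inst] at this
  exact this

/-- The Boolean axiom at the identity: `∀ x_t x` is literally `F`. -/
theorem and_tt_ff : Thm Ax (.eq (and tt ff) (ff : Tm K Γ Ty.t)) :=
  bool_inst b0

theorem tt_and (A : Tm K Γ Ty.t) : Thm Ax (.eq (and tt A) A) := by
  have h := eqMP (bool_inst (Ax := Ax) (.eq (and tt b0) (b0 : Tm K (Ty.t :: Γ) Ty.t)))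
    (and_intro_eq and_tt_tt and_tt_ff)
  exact all_elim h A

/-- By extensionality `F`, an equation of two functions, equals `∀ x (T = x)`. The Boolean axiom
makes this `(T = T) ∧ (T = F)`, whose first conjunct is `T`. -/
theorem tt_eq_ff : Thm Ax (.eq (.eq tt ff) (ff : Tm K Γ Ty.t)) := by
  have h1 := funext (Ax := Ax) (.lam tt : Tm K Γ (Ty.t ⇒ₜ Ty.t)) (.lam b0)
  have h2 : Thm Ax (.eq ff (all (.eq tt (b0 : Tm K (Ty.t :: Γ) Ty.t)))) :=
    h1.trans (all_congr (congEq (beta _ _) (beta _ _)))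
  have h3 := bool_inst (Ax := Ax) (.eq tt (b0 : Tm K (Ty.t :: Γ) Ty.t))
  have h4 := h3.trans h2.symm
  exact ((tt_and _).symm.trans (and_congr (tt_eq_refl tt) (refl _))).trans h4

/-- The bridge between provability of `A` and the equation `T = A`; checking the two truth values
suffices. -/
theorem tt_eq (A : Tm K Γ Ty.t) : Thm Ax (.eq (.eq tt A) A) := by
  have h := eqMP (bool_inst (Ax := Ax) (.eq (.eq tt b0) (b0 : Tm K (Ty.t :: Γ) Ty.t)))
    (and_intro_eq (tt_eq_refl tt).symm tt_eq_ff)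
  exact all_elim h A

theorem eq_tt {A : Tm K Γ Ty.t} (h : Thm Ax A) : Thm Ax (.eq A tt) :=
  (eqMPR (tt_eq A) h).symm

theorem and_intro {A B : Tm K Γ Ty.t} (h : Thm Ax A) (h' : Thm Ax B) : Thm Ax (and A B) :=
  eqMPR ((and_congr (eq_tt h) (eq_tt h')).trans and_tt_tt) truth

/-- The rule of cases. -/
theorem cases (P : Tm K (Ty.t :: Γ) Ty.t) (A : Tm K Γ Ty.t) (h : Thm Ax (P.subst (instSub tt)))
    (h' : Thm Ax (P.subst (instSub ff))) : Thm Ax (P.subst (instSub A)) :=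
  all_elim (eqMP (bool_inst P) (and_intro h h')) A

theorem imp_def (A B : Tm K Γ Ty.t) : Thm Ax (.eq (imp A B) (.eq A (and A B))) := by
  have h := beta₂ (Ax := Ax) (.eq b1 (and b1 b0)) A B
  simp at h
  exact h

theorem or_def (A B : Tm K Γ Ty.t) : Thm Ax (.eq (or A B) (not (and (not A) (not B)))) := by
  have h := beta₂ (Ax := Ax) (not (and (not b1) (not b0))) A B
  simp at h
  exact h

/-- Leibniz' law. -/
theorem leibniz_subst (P : Tm K (α :: Γ) Ty.t) (A B : Tm K Γ α) :
    Thm Ax (imp (.eq A B) (.eq (P.subst (instSub A)) (P.subst (instSub B)))) :=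
  eqMP (imp_congr (refl _) (congEq (beta P A) (beta P B))) (leibniz A B (.lam P))

theorem all_imp_inst (P : Tm K (α :: Γ) Ty.t) (A : Tm K Γ α) :
    Thm Ax (imp (all P) (P.subst (instSub A))) := by
  have h := leibniz_subst (Ax := Ax) (.app b0 A.wk) (.lam tt) (.lam P)
  simp only [Tm.subst, instSub_zero, Tm.wk_subst_instSub] at h
  exact eqMP (imp_congr (refl _) ((congEq (beta tt A) (beta P A)).trans (tt_eq _))) h

/-- `F` is `∀ x_t x`, hence implies every `A`, and implication is by definition the equation `F = (F
∧ A)`. -/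
theorem ff_and (A : Tm K Γ Ty.t) : Thm Ax (.eq (and ff A) ff) :=
  (eqMP (imp_def _ _) (all_imp_inst b0 A)).symm

theorem and_ff (A : Tm K Γ Ty.t) : Thm Ax (.eq (and A ff) ff) :=
  cases (.eq (and b0 ff) ff) A and_tt_ff (ff_and ff)

/-- Leibniz' law for the property `x = F` shows that `F = T` implies `(F = F) = (T = F)`, which
reduces to `F`. A formula implying `F` equals its conjunction with `F`, that is, `F`. -/
theorem ff_eq_tt : Thm Ax (.eq (.eq ff tt) (ff : Tm K Γ Ty.t)) := by
  have h := leibniz_subst (Ax := Ax) (.eq b0 ff) (ff : Tm K Γ Ty.t) tt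
  simp only [Tm.subst, instSub_zero, ff_subst] at h
  have h1 := eqMP (imp_congr (refl _)
    ((congEq (tt_eq_refl ff).symm tt_eq_ff).trans (tt_eq _))) h
  exact (eqMP (imp_def _ _) h1).trans (and_ff _)

end Thm

/-! ### Tautologies -/

/-- Propositional formulas in `k` variables. -/
inductive PropForm (k : ℕ) : Type
  | var : Fin k → PropForm k
  | tt : PropForm k
  | ff : PropForm k
  | eq : PropForm k → PropForm k → PropForm k
  | and : PropForm k → PropForm k → PropForm k
  | imp : PropForm k → PropForm k → PropForm k
  | or : PropForm k → PropForm k → PropForm k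
  | not : PropForm k → PropForm k

namespace PropForm

variable {k : ℕ}

/-- The truth value of a propositional formula. -/
def eval (v : Fin k → Bool) : PropForm k → Bool
  | var i => v i
  | tt => true
  | ff => false
  | eq A B => A.eval v == B.eval v
  | and A B => A.eval v && B.eval v
  | imp A B => !A.eval v || B.eval v
  | or A B => A.eval v || B.eval v
  | not A => !A.eval v

/-- The formula obtained by substituting formulas for the propositional variables. -/
def interp (σ : Fin k → Tm K Γ Ty.t) : PropForm k → Tm K Γ Ty.t
  | var i => σ i
  | tt => TyN.tt
  | ff => TyN.ff
  | eq A B => .eq (A.interp σ) (B.interp σ)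
  | and A B => TyN.and (A.interp σ) (B.interp σ)
  | imp A B => TyN.imp (A.interp σ) (B.interp σ)
  | or A B => TyN.or (A.interp σ) (B.interp σ)
  | not A => TyN.not (A.interp σ)

theorem interp_subst {Θ : List (Ty n)} (φ : PropForm k) (σ : Fin k → Tm K Γ Ty.t)
    (τ : ∀ α, Idx Γ α → Tm K Θ α) :
    (φ.interp σ).subst τ = φ.interp (fun i => (σ i).subst τ) := by
  induction φ <;>
    simp_all only [interp, Tm.subst, tt_subst, ff_subst, and_subst, imp_subst, or_subst, not_subst]

end PropForm

/-- The truth value `b` as a term. -/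
def boolT (b : Bool) : Tm K Γ Ty.t := if b then tt else ff

namespace Thm

theorem eq_boolT (a b : Bool) :
    Thm Ax (.eq (.eq (boolT a) (boolT b)) (boolT (a == b) : Tm K Γ Ty.t)) := by
  cases a <;> cases b
  · exact (tt_eq_refl _).symm
  · exact ff_eq_tt
  · exact tt_eq_ff
  · exact (tt_eq_refl _).symm

theorem and_boolT (a b : Bool) :
    Thm Ax (.eq (and (boolT a) (boolT b)) (boolT (a && b) : Tm K Γ Ty.t)) := by
  cases a <;> cases b
  · exact ff_and _
  · exact ff_and _
  · exact and_tt_ff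
  · exact and_tt_tt

theorem not_boolT (a : Bool) : Thm Ax (.eq (not (boolT a)) (boolT (!a) : Tm K Γ Ty.t)) := by
  cases a
  · exact (tt_eq_refl _).symm
  · exact ff_eq_tt

theorem imp_boolT (a b : Bool) :
    Thm Ax (.eq (imp (boolT a) (boolT b)) (boolT (!a || b) : Tm K Γ Ty.t)) := by
  have h := (imp_def (Ax := Ax) (boolT a) (boolT b : Tm K Γ Ty.t)).trans
    ((congEq (refl _) (and_boolT a b)).trans (eq_boolT a (a && b)))
  cases a <;> cases b <;> exact h

theorem or_boolT (a b : Bool) :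
    Thm Ax (.eq (or (boolT a) (boolT b)) (boolT (a || b) : Tm K Γ Ty.t)) := by
  have h := (or_def (Ax := Ax) (boolT a) (boolT b : Tm K Γ Ty.t)).trans
    ((not_congr ((and_congr (not_boolT a) (not_boolT b)).trans (and_boolT _ _))).trans
      (not_boolT _))
  cases a <;> cases b <;> exact h

theorem interp_boolT {k : ℕ} (φ : PropForm k) (v : Fin k → Bool) :
    Thm Ax (.eq (φ.interp (fun i => boolT (v i))) (boolT (φ.eval v) : Tm K Γ Ty.t)) := by
  induction φ with
  | var i => exact refl _
  | tt => exact refl _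
  | ff => exact refl _
  | eq A B hA hB => exact (congEq hA hB).trans (eq_boolT _ _)
  | and A B hA hB => exact (and_congr hA hB).trans (and_boolT _ _)
  | imp A B hA hB => exact (imp_congr hA hB).trans (imp_boolT _ _)
  | or A B hA hB => exact (or_congr hA hB).trans (or_boolT _ _)
  | not A hA => exact (not_congr hA).trans (not_boolT _)

/-- Induction on the set of variables already replaced by arbitrary formulas; the others hold truth
values. With none replaced this is a truth-table computation, and each further variable is freed by
the rule of cases. -/
theorem taut_aux {k : ℕ} (φ : PropForm k) (h : ∀ v, φ.eval v = true) (s : Finset (Fin k)) :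
    ∀ (v : Fin k → Bool) (σ : Fin k → Tm K Γ Ty.t),
      Thm Ax (φ.interp (fun i => if i ∈ s then σ i else boolT (v i))) := by
  induction s using Finset.induction_on with
  | empty =>
    intro v σ
    refine eqMPR (by simpa using interp_boolT φ v) ?_
    rw [h v]
    exact truth
  | insert j s hj ih =>
    intro v σ
    -- The predicate for the rule of cases has the bound variable at place `j` and everything else
    -- weakened past it.
    have key : ∀ B : Tm K Γ Ty.t, (φ.interp fun i => if i = j then b0 else
        ((if i ∈ s then σ i else boolT (v i)) : Tm K Γ Ty.t).wk).subst (instSub B) =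
        φ.interp fun i => if i = j then B else if i ∈ s then σ i else boolT (v i) := by
      intro B
      rw [PropForm.interp_subst]
      congr 1
      funext i
      by_cases hi : i = j <;> simp [hi]
    have hb : ∀ b : Bool, Thm Ax (φ.interp fun i => if i = j then (boolT b : Tm K Γ Ty.t) else
        if i ∈ s then σ i else boolT (v i)) := by
      intro b
      have := ih (Function.update v j b) σ
      convert this using 3 with i
      by_cases hi : i = j
      · subst hi; simp [hj]
      · simp [hi]
    have := cases (Ax := Ax) (φ.interp fun i => if i = j then b0 else
        ((if i ∈ s then σ i else boolT (v i)) : Tm K Γ Ty.t).wk) (σ j)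
        (by rw [key]; exact hb true) (by rw [key]; exact hb false)
    rw [key] at this
    convert this using 3 with i
    by_cases hi : i = j
    · subst hi; simp
    · simp [hi]

/-- Substitution instances of tautologies are theorems. -/
theorem taut {k : ℕ} (φ : PropForm k) (h : ∀ v, φ.eval v = true) (σ : Fin k → Tm K Γ Ty.t) :
    Thm Ax (φ.interp σ) := by
  simpa using taut_aux (Ax := Ax) φ h Finset.univ (fun _ => true) σ


/-! ### Propositional, quantifier and equality rules. -/

theorem mp {A B : Tm K Γ Ty.t} (h : Thm Ax (imp A B)) (hA : Thm Ax A) : Thm Ax B := by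
  have h1 := taut (Ax := Ax) (k := 1) (.eq (.imp .tt (.var 0)) (.var 0)) (by decide) ![B]
  exact eqMP ((imp_congr (eq_tt hA).symm (refl _)).symm.trans h1) h

theorem imp_of_eq {A B : Tm K Γ Ty.t} (h : Thm Ax (.eq A B)) : Thm Ax (imp A B) :=
  eqMP (imp_congr (refl A) h) (taut (k := 1) (.imp (.var 0) (.var 0)) (by decide) ![A])

theorem eq_of_imp {A B : Tm K Γ Ty.t} (h : Thm Ax (imp A B)) (h' : Thm Ax (imp B A)) :
    Thm Ax (.eq A B) :=
  ((taut (k := 2) (.imp (.imp (.var 0) (.var 1)) (.imp (.imp (.var 1) (.var 0))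
    (.eq (.var 0) (.var 1)))) (by decide) ![A, B]).mp h).mp h'

theorem imp_trans {A B C : Tm K Γ Ty.t} (h : Thm Ax (imp A B)) (h' : Thm Ax (imp B C)) :
    Thm Ax (imp A C) :=
  ((taut (k := 3) (.imp (.imp (.var 0) (.var 1)) (.imp (.imp (.var 1) (.var 2))
    (.imp (.var 0) (.var 2)))) (by decide) ![A, B, C]).mp h).mp h'

theorem imp_and {A B C : Tm K Γ Ty.t} (h : Thm Ax (imp A B)) (h' : Thm Ax (imp A C)) :
    Thm Ax (imp A (and B C)) :=
  ((taut (k := 3) (.imp (.imp (.var 0) (.var 1)) (.imp (.imp (.var 0) (.var 2))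
    (.imp (.var 0) (.and (.var 1) (.var 2))))) (by decide) ![A, B, C]).mp h).mp h'

theorem or_imp {A B C : Tm K Γ Ty.t} (h : Thm Ax (imp A C)) (h' : Thm Ax (imp B C)) :
    Thm Ax (imp (or A B) C) :=
  ((taut (k := 3) (.imp (.imp (.var 0) (.var 2)) (.imp (.imp (.var 1) (.var 2))
    (.imp (.or (.var 0) (.var 1)) (.var 2)))) (by decide) ![A, B, C]).mp h).mp h'

theorem imp_or_left (A B : Tm K Γ Ty.t) : Thm Ax (imp A (or A B)) :=
  taut (k := 2) (.imp (.var 0) (.or (.var 0) (.var 1))) (by decide) ![A, B]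

theorem imp_or_right (A B : Tm K Γ Ty.t) : Thm Ax (imp B (or A B)) :=
  taut (k := 2) (.imp (.var 1) (.or (.var 0) (.var 1))) (by decide) ![A, B]

theorem and_imp_left (A B : Tm K Γ Ty.t) : Thm Ax (imp (and A B) A) :=
  taut (k := 2) (.imp (.and (.var 0) (.var 1)) (.var 0)) (by decide) ![A, B]

theorem and_imp_right (A B : Tm K Γ Ty.t) : Thm Ax (imp (and A B) B) :=
  taut (k := 2) (.imp (.and (.var 0) (.var 1)) (.var 1)) (by decide) ![A, B]

theorem imp_const {A B : Tm K Γ Ty.t} (h : Thm Ax B) : Thm Ax (imp A B) :=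
  (taut (k := 2) (.imp (.var 1) (.imp (.var 0) (.var 1))) (by decide) ![A, B]).mp h

theorem contrapose {A B : Tm K Γ Ty.t} (h : Thm Ax (imp A B)) : Thm Ax (imp (not B) (not A)) :=
  (taut (k := 2) (.imp (.imp (.var 0) (.var 1)) (.imp (.not (.var 1)) (.not (.var 0))))
    (by decide) ![A, B]).mp h

theorem not_not_eq (A : Tm K Γ Ty.t) : Thm Ax (.eq (not (not A)) A) :=
  taut (k := 1) (.eq (.not (.not (.var 0))) (.var 0)) (by decide) ![A]

theorem all_intro {P : Tm K (α :: Γ) Ty.t} (h : Thm Ax P) : Thm Ax (all P) :=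
  congLam (eq_tt h).symm

/-- Cases on the truth value of `Q`, which does not contain the quantified variable: for `T` both
sides reduce to `∀ x P`, for `F` the conclusion is vacuous. -/
theorem all_imp_distrib (Q : Tm K Γ Ty.t) (P : Tm K (α :: Γ) Ty.t) :
    Thm Ax (imp (all (imp Q.wk P)) (imp Q (all P))) := by
  have h := cases (Ax := Ax) (imp (all (imp b1 (P.rename (liftRen (fun _ i => .succ i) α))))
    (imp b0 (all (P.rename (liftRen (fun _ i => .succ i) α))))) Q
  simp only [imp_subst, all_subst, Tm.subst, liftSub_succ, instSub_zero, tt_wk, ff_wk,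
    Tm.rename_liftRen_subst_liftSub] at h
  apply h
  · refine eqMPR (imp_congr (all_congr (B := P) ?_) (refl _)) ?_
    · exact taut (k := 1) (.eq (.imp .tt (.var 0)) (.var 0)) (by decide) ![P]
    · exact taut (k := 1) (.imp (.var 0) (.imp .tt (.var 0))) (by decide) ![all P]
  · exact taut (k := 2) (.imp (.var 0) (.imp .ff (.var 1))) (by decide) ![_, _]

theorem imp_all {Q : Tm K Γ Ty.t} {P : Tm K (α :: Γ) Ty.t} (h : Thm Ax (imp Q.wk P)) :
    Thm Ax (imp Q (all P)) := (all_imp_distrib Q P).mp (all_intro h)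

theorem inst_imp_ex (P : Tm K (α :: Γ) Ty.t) (A : Tm K Γ α) :
    Thm Ax (imp (P.subst (instSub A)) (ex P)) :=
  imp_trans (imp_of_eq (not_not_eq _).symm) (contrapose (all_imp_inst (not P) A))

theorem ex_imp {Q : Tm K Γ Ty.t} {P : Tm K (α :: Γ) Ty.t} (h : Thm Ax (imp P Q.wk)) :
    Thm Ax (imp (ex P) Q) :=
  imp_trans (contrapose (imp_all (Q := not Q) (contrapose h))) (imp_of_eq (not_not_eq Q))

theorem imp_ex_wk (P : Tm K (α :: Γ) Ty.t) : Thm Ax (imp P (ex P).wk) := by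
  have h := inst_imp_ex (Ax := Ax) (P.rename (liftRen (fun _ i => .succ i) α)) b0
  rw [Tm.rename_liftRen_inst] at h
  exact h

theorem ex_imp_ex {P Q : Tm K (α :: Γ) Ty.t} (h : Thm Ax (imp P Q)) :
    Thm Ax (imp (ex P) (ex Q)) := ex_imp (imp_trans h (imp_ex_wk Q))

theorem ex_or (P Q : Tm K (α :: Γ) Ty.t) :
    Thm Ax (.eq (ex (or P Q)) (or (ex P) (ex Q))) := by
  apply eq_of_imp
  · apply ex_imp
    exact or_imp (imp_trans (imp_ex_wk P) (imp_or_left _ _))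
      (imp_trans (imp_ex_wk Q) (imp_or_right _ _))
  · exact or_imp (ex_imp_ex (imp_or_left _ _)) (ex_imp_ex (imp_or_right _ _))

theorem ex_ff : Thm Ax (.eq (ex (ff : Tm K (α :: Γ) Ty.t)) ff) :=
  eq_of_imp (ex_imp (imp_of_eq (refl _)))
    (taut (k := 1) (.imp .ff (.var 0)) (by decide) ![_])

/-- Replacement of equals in a formula, as an implication. -/
theorem eq_and_imp (P : Tm K (α :: Γ) Ty.t) (A B : Tm K Γ α) :
    Thm Ax (imp (and (.eq A B) (P.subst (instSub A))) (P.subst (instSub B))) :=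
  (taut (k := 3) (.imp (.imp (.var 0) (.eq (.var 1) (.var 2)))
    (.imp (.and (.var 0) (.var 1)) (.var 2))) (by decide) ![_, _, _]).mp (leibniz_subst P A B)

/-- Equal objects have equal images, as an implication. -/
theorem eq_imp_eq (M : Tm K (α :: Γ) β) (A B : Tm K Γ α) :
    Thm Ax (imp (.eq A B) (.eq (M.subst (instSub A)) (M.subst (instSub B)))) := by
  have h := leibniz_subst (Ax := Ax) (.eq (M.subst (instSub A)).wk M) A B
  simp only [Tm.subst, Tm.wk_subst_instSub] at h
  exact ((taut (k := 3) (.imp (.imp (.var 0) (.eq (.var 1) (.var 2)))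
    (.imp (.var 1) (.imp (.var 0) (.var 2)))) (by decide) ![_, _, _]).mp h).mp (refl _)

theorem eq_symm_imp (A B : Tm K Γ α) : Thm Ax (imp (.eq A B) (.eq B A)) := by
  have h := eq_and_imp (Ax := Ax) (.eq b0 A.wk) A B
  simp only [Tm.subst, Tm.wk_subst_instSub, instSub_zero] at h
  exact imp_trans (imp_and (imp_of_eq (refl _)) (imp_const (refl A))) h

theorem eq_trans_imp (A B C : Tm K Γ α) : Thm Ax (imp (and (.eq A B) (.eq B C)) (.eq A C)) := by
  have h := eq_and_imp (Ax := Ax) (.eq A.wk b0) B C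
  simp only [Tm.subst, Tm.wk_subst_instSub, instSub_zero] at h
  exact imp_trans (imp_and (and_imp_right _ _) (and_imp_left _ _)) h

/-- The one-point rule, which eliminates the existential for each disjunct of the meaning list. -/
theorem ex_eq_and (A : Tm K Γ α) (P : Tm K (α :: Γ) Ty.t) :
    Thm Ax (.eq (ex (and (.eq b0 A.wk) P)) (P.subst (instSub A))) := by
  apply eq_of_imp
  · apply ex_imp
    have h := eq_and_imp (Ax := Ax) (P.rename (liftRen (fun _ i => .succ i) α)) b0 A.wk
    rw [Tm.rename_liftRen_inst] at h
    convert h using 2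
    simp only [Tm.wk, Tm.subst_rename, Tm.rename_subst]
    congr 1
    funext β i
    cases i <;> rfl
  · have h := inst_imp_ex (Ax := Ax) (and (.eq b0 A.wk) P) A
    simp only [and_subst, Tm.subst, instSub_zero, Tm.wk_subst_instSub] at h
    exact imp_trans (imp_and (imp_const (refl A)) (imp_of_eq (refl _))) h

theorem eta (f : Tm K Γ (α ⇒ₜ β)) : Thm Ax (.eq (.lam (.app f.wk b0)) f) := by
  refine eqMPR (funext _ _) (all_intro ?_)
  have h := beta (Ax := Ax) (α := α) (.app f.wk.wk b0) (b0 : Tm K (α :: Γ) α)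
  simp only [Tm.inst, Tm.subst, Tm.wk_subst_instSub, instSub_zero] at h
  simpa [Tm.wk_lam] using h

end Thm

namespace Derives

variable {Δ : Set (Tm K [] Ty.t)} {A B : Tm K [] Ty.t}

theorem mpThm (h : Derives Ax Δ A) (h' : Thm Ax (imp A B)) : Derives Ax Δ B := mp (thm h') h

theorem and_intro (h : Derives Ax Δ A) (h' : Derives Ax Δ B) : Derives Ax Δ (and A B) :=
  mp (mp (thm (Thm.taut (k := 2) (.imp (.var 0) (.imp (.var 1) (.and (.var 0) (.var 1))))
    (by decide) ![A, B])) h) h'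

end Derives

/-! ### Raising of objects and predicates. -/

/-- The first component `λ x_γ π₁ (X x_γ)` of a family of pairs. -/
def fstFam (X : Tm K Γ (γ ⇒ₜ α ×ₜ β)) : Tm K Γ (γ ⇒ₜ α) := .lam (.fst (.app X.wk b0))

/-- The second component `λ x_γ π₂ (X x_γ)` of a family of pairs. -/
def sndFam (X : Tm K Γ (γ ⇒ₜ α ×ₜ β)) : Tm K Γ (γ ⇒ₜ β) := .lam (.snd (.app X.wk b0))

/-- `λ x_γ (F A x_γ, A)`. -/
def raiseT (F : Tm K Γ (α ⇒ₜ γ ⇒ₜ γ)) (A : Tm K Γ α) : Tm K Γ (γ ⇒ₜ γ ×ₜ α) :=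
  .lam (.pair (.app (.app F.wk A.wk) b0) A.wk)

/-- The components of `X` are `F A` and the constant function `A`. -/
def raiseRel (F : Tm K Γ (α ⇒ₜ γ ⇒ₜ γ)) (A : Tm K Γ α) (X : Tm K Γ (γ ⇒ₜ γ ×ₜ α)) :
    Tm K Γ Ty.t :=
  and (.eq (fstFam X) (.app F A)) (.eq (sndFam X) (.lam A.wk))

/-- Some object with the property `M` is related to `X` by `raiseRel F`. -/
def raiseEx (M : Tm K Γ (α ⇒ₜ Ty.t)) (F : Tm K Γ (α ⇒ₜ γ ⇒ₜ γ)) (X : Tm K Γ (γ ⇒ₜ γ ×ₜ α)) :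
    Tm K Γ Ty.t :=
  ex (and (.app M.wk b0) (raiseRel F.wk b0 X.wk))

/-- The raising of a predicate. -/
def raisePred (M : Tm K Γ (α ⇒ₜ Ty.t)) (F : Tm K Γ (α ⇒ₜ γ ⇒ₜ γ)) :
    Tm K Γ ((γ ⇒ₜ γ ×ₜ α) ⇒ₜ Ty.t) :=
  .lam (raiseEx M.wk F.wk b0)

@[simp] theorem raiseRel_subst {Θ : List (Ty n)} (σ : ∀ α, Idx Γ α → Tm K Θ α)
    (F : Tm K Γ (α ⇒ₜ γ ⇒ₜ γ)) (A : Tm K Γ α) (X : Tm K Γ (γ ⇒ₜ γ ×ₜ α)) :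
    (raiseRel F A X).subst σ = raiseRel (F.subst σ) (A.subst σ) (X.subst σ) := by
  simp [raiseRel, fstFam, sndFam]

@[simp] theorem raiseEx_subst {Θ : List (Ty n)} (σ : ∀ α, Idx Γ α → Tm K Θ α)
    (M : Tm K Γ (α ⇒ₜ Ty.t)) (F : Tm K Γ (α ⇒ₜ γ ⇒ₜ γ)) (X : Tm K Γ (γ ⇒ₜ γ ×ₜ α)) :
    (raiseEx M F X).subst σ = raiseEx (M.subst σ) (F.subst σ) (X.subst σ) := by
  simp [raiseEx]

theorem raiseT_wk (F : Tm K Γ (α ⇒ₜ γ ⇒ₜ γ)) (A : Tm K Γ α) :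
    (raiseT F A).wk (β := β) = raiseT F.wk A.wk := by
  simp [raiseT, Tm.wk_lam]

theorem bigOrEq_wk (l : List (Tm K Γ α)) :
    (bigOrEq l).wk (β := β) = bigOrEq (l.map Tm.wk) := by
  induction l with
  | nil => rfl
  | cons A l ih => simp [bigOrEq, ← ih, orPred, eqTo, Tm.wk_lam]

namespace Thm

theorem bigOrEq_nil_app (X : Tm K Γ α) : Thm Ax (.eq (.app (bigOrEq []) X) ff) := beta _ _

theorem bigOrEq_cons_app (A : Tm K Γ α) (l : List (Tm K Γ α)) (X : Tm K Γ α) :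
    Thm Ax (.eq (.app (bigOrEq (A :: l)) X) (or (.eq X A) (.app (bigOrEq l) X))) := by
  have h := beta (Ax := Ax) (or (.app (eqTo A).wk b0) (.app (bigOrEq l).wk b0)) X
  simp only [Tm.inst, or_subst, Tm.subst, Tm.wk_subst_instSub, instSub_zero] at h
  refine h.trans (or_congr ?_ (refl _))
  have h' := beta (Ax := Ax) (.eq b0 A.wk) X
  simp only [Tm.inst, Tm.subst, Tm.wk_subst_instSub, instSub_zero] at h'
  exact h'

theorem raisePred_app (M : Tm K Γ (α ⇒ₜ Ty.t)) (F : Tm K Γ (α ⇒ₜ γ ⇒ₜ γ))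
    (X : Tm K Γ (γ ⇒ₜ γ ×ₜ α)) : Thm Ax (.eq (.app (raisePred M F) X) (raiseEx M F X)) := by
  have h := beta (Ax := Ax) (raiseEx M.wk F.wk b0) X
  simp only [Tm.inst, raiseEx_subst, Tm.subst, Tm.wk_subst_instSub, instSub_zero] at h
  exact h

theorem fstFam_congr {X Y : Tm K Γ (γ ⇒ₜ α ×ₜ β)} :
    Thm Ax (imp (.eq X Y) (.eq (fstFam X) (fstFam Y))) := by
  have h := eq_imp_eq (Ax := Ax) (fstFam b0) X Y
  simpa [fstFam] using h

theorem sndFam_congr {X Y : Tm K Γ (γ ⇒ₜ α ×ₜ β)} :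
    Thm Ax (imp (.eq X Y) (.eq (sndFam X) (sndFam Y))) := by
  have h := eq_imp_eq (Ax := Ax) (sndFam b0) X Y
  simpa [sndFam] using h

theorem fstFam_raiseT (F : Tm K Γ (α ⇒ₜ γ ⇒ₜ γ)) (A : Tm K Γ α) :
    Thm Ax (.eq (fstFam (raiseT F A)) (.app F A)) := by
  refine trans (congLam ?_) (eta _)
  have h := beta (Ax := Ax) (.pair (.app (.app F.wk.wk A.wk.wk) b0) A.wk.wk)
    (b0 : Tm K (γ :: Γ) γ)
  simp only [Tm.inst, Tm.subst, Tm.wk_subst_instSub, instSub_zero] at h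
  rw [raiseT_wk]
  exact (congFst h).trans (fst_pair _ _)

theorem sndFam_raiseT (F : Tm K Γ (α ⇒ₜ γ ⇒ₜ γ)) (A : Tm K Γ α) :
    Thm Ax (.eq (sndFam (raiseT F A)) (.lam A.wk)) := by
  refine congLam ?_
  have h := beta (Ax := Ax) (.pair (.app (.app F.wk.wk A.wk.wk) b0) A.wk.wk)
    (b0 : Tm K (γ :: Γ) γ)
  simp only [Tm.inst, Tm.subst, Tm.wk_subst_instSub, instSub_zero] at h
  rw [raiseT_wk]
  exact (congSnd h).trans (snd_pair _ _)

/-- A family of pairs is determined by its components. -/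
theorem fam_eta (X : Tm K Γ (γ ⇒ₜ α ×ₜ β)) :
    Thm Ax (.eq (.lam (.pair (.app (fstFam X).wk b0) (.app (sndFam X).wk b0))) X) := by
  refine trans (congLam ?_) (eta X)
  refine trans (congPair ?_ ?_) (pair_eta _)
  · have h := beta (Ax := Ax) (.fst (.app X.wk.wk b0)) (b0 : Tm K (γ :: Γ) γ)
    simpa [Tm.inst, fstFam, Tm.wk_lam] using h
  · have h := beta (Ax := Ax) (.snd (.app X.wk.wk b0)) (b0 : Tm K (γ :: Γ) γ)
    simpa [Tm.inst, sndFam, Tm.wk_lam] using h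

/-- Left to right, `X` is rebuilt from its components (`fam_eta`), which are then exchanged for `F
A` and the constant function; right to left, the components of `raiseT F A` are computed. -/
theorem raiseRel_eq (F : Tm K Γ (α ⇒ₜ γ ⇒ₜ γ)) (A : Tm K Γ α) (X : Tm K Γ (γ ⇒ₜ γ ×ₜ α)) :
    Thm Ax (.eq (raiseRel F A X) (.eq X (raiseT F A))) := by
  apply eq_of_imp
  -- The two components are replaced one at a time: `h1` the first, `h2` the second.
  · have h1 := eq_imp_eq (Ax := Ax) (.lam (.pair (.app b1 b0) (.app (sndFam X).wk.wk b0)))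
      (fstFam X) (.app F A)
    have h2 := eq_imp_eq (Ax := Ax) (.lam (.pair (.app (Tm.app F A).wk.wk b0) (.app b1 b0)))
      (sndFam X) (.lam A.wk)
    simp only [Tm.subst, Tm.wk_subst_liftSub, Tm.wk_subst_instSub, instSub_zero, liftSub_succ,
      liftSub_zero] at h1 h2
    have h3 : Thm Ax (.eq (.lam (.pair (.app (Tm.app F A).wk b0) (.app ((Tm.lam A.wk : Tm K Γ (γ ⇒ₜ α)).wk) b0)))
        (raiseT F A)) := by
      refine congLam (congPair (refl _) ?_)
      have h := beta (Ax := Ax) A.wk.wk (b0 : Tm K (γ :: Γ) γ)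
      simpa [Tm.inst, Tm.wk_lam] using h
    exact imp_trans (imp_trans (imp_and (imp_trans (and_imp_left _ _) h1)
      (imp_trans (and_imp_right _ _) h2)) (eq_trans_imp _ _ _)) (imp_of_eq (congEq (fam_eta X) h3))
  · exact imp_and
      (imp_trans fstFam_congr (imp_of_eq (congEq (refl _) (fstFam_raiseT F A))))
      (imp_trans sndFam_congr (imp_of_eq (congEq (refl _) (sndFam_raiseT F A))))

theorem raiseEx_bigOrEq (F : Tm K Γ (α ⇒ₜ γ ⇒ₜ γ)) (X : Tm K Γ (γ ⇒ₜ γ ×ₜ α))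
    (l : List (Tm K Γ α)) :
    Thm Ax (.eq (raiseEx (bigOrEq l) F X) (.app (bigOrEq (l.map (raiseT F))) X)) := by
  induction l with
  | nil =>
    refine trans (trans (ex_congr ?_) ex_ff) (bigOrEq_nil_app X).symm
    exact (and_congr (bigOrEq_nil_app b0) (refl _)).trans (ff_and _)
  | cons A l ih =>
    refine trans ?_ (bigOrEq_cons_app _ _ _).symm
    have h : Thm Ax (.eq (raiseEx (bigOrEq (A :: l)) F X)
        (or (ex (and (.eq b0 A.wk) (raiseRel F.wk b0 X.wk))) (raiseEx (bigOrEq l) F X))) := by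
      refine trans (ex_congr ?_) (ex_or _ _)
      rw [bigOrEq_wk, bigOrEq_wk, List.map_cons]
      refine (and_congr (bigOrEq_cons_app _ _ _) (refl _)).trans ?_
      exact taut (k := 3) (.eq (.and (.or (.var 0) (.var 1)) (.var 2))
        (.or (.and (.var 0) (.var 2)) (.and (.var 1) (.var 2)))) (by decide) ![_, _, _]
    refine h.trans (or_congr ((ex_eq_and _ _).trans ?_) ih)
    simpa using raiseRel_eq (Ax := Ax) F A X

theorem raisePred_bigOrEq (F : Tm K Γ (α ⇒ₜ γ ⇒ₜ γ)) (l : List (Tm K Γ α)) :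
    Thm Ax (.eq (raisePred (bigOrEq l) F) (bigOrEq (l.map (raiseT F)))) := by
  refine trans (congLam ?_) (eta _)
  rw [bigOrEq_wk, bigOrEq_wk]
  have h := raiseEx_bigOrEq (Ax := Ax) F.wk b0 (l.map (Tm.wk (β := γ ⇒ₜ γ ×ₜ α)))
  simpa [Function.comp_def, raiseT_wk] using h

theorem raisePred_congr (F : Tm K Γ (α ⇒ₜ γ ⇒ₜ γ)) (M M' : Tm K Γ (α ⇒ₜ Ty.t)) :
    Thm Ax (imp (.eq M M') (.eq (raisePred M F) (raisePred M' F))) := by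
  have h := eq_imp_eq (Ax := Ax) (raisePred b0 F.wk) M M'
  simpa [raisePred] using h

theorem imp_raiseEx (M : Tm K Γ (α ⇒ₜ Ty.t)) (F : Tm K Γ (α ⇒ₜ γ ⇒ₜ γ)) (A : Tm K Γ α)
    (X : Tm K Γ (γ ⇒ₜ γ ×ₜ α)) :
    Thm Ax (imp (and (.app M A) (raiseRel F A X)) (raiseEx M F X)) := by
  have h := inst_imp_ex (Ax := Ax) (and (.app M.wk b0) (raiseRel F.wk b0 X.wk)) A
  simp only [and_subst, raiseRel_subst, Tm.subst, Tm.wk_subst_instSub, instSub_zero] at h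
  exact h

/-- The raised object determines the object: it is the second component at any context. -/
theorem raiseEx_imp (M : Tm K Γ (α ⇒ₜ Ty.t)) (F : Tm K Γ (α ⇒ₜ γ ⇒ₜ γ))
    (X : Tm K Γ (γ ⇒ₜ γ ×ₜ α)) (C : Tm K Γ γ) :
    Thm Ax (imp (raiseEx M F X) (and (.app M (.snd (.app X C)))
      (raiseRel F (.snd (.app X C)) X))) := by
  apply ex_imp
  -- Evaluating the second component at `C` identifies the bound variable with `π₂ (X C)`.
  have h1 := eq_imp_eq (Ax := Ax) (.app b0 C.wk.wk) (sndFam X.wk) (.lam (b1 : Tm K (γ :: α :: Γ) α))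
  simp only [Tm.subst, Tm.wk_subst_instSub, instSub_zero] at h1
  have h2 : Thm Ax (.eq (.app (sndFam X.wk) C.wk) (.snd (.app X.wk (C.wk (β := α))))) := by
    have h := beta (Ax := Ax) (.snd (.app X.wk.wk b0)) (C.wk (β := α))
    simp only [Tm.inst, Tm.subst, Tm.wk_subst_instSub, instSub_zero] at h
    exact h
  have h3 : Thm Ax (.eq (.app (.lam (b1 : Tm K (γ :: α :: Γ) α)) C.wk) b0) := beta _ _
  have h4 := h1.imp_trans (imp_of_eq ((congEq h2 h3).trans
    (eq_of_imp (eq_symm_imp _ _) (eq_symm_imp _ _))))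
  -- Rewriting the whole body along this equation removes the bound variable from the conclusion, as
  -- existential elimination requires.
  have h5 := eq_and_imp (Ax := Ax) (and (.app M.wk.wk b0) (raiseRel F.wk.wk b0 X.wk.wk))
    b0 (.snd (.app X.wk (C.wk (β := α))))
  simp only [and_subst, raiseRel_subst, Tm.subst, Tm.wk_subst_instSub, instSub_zero] at h5
  have h6 := imp_trans (imp_and (imp_trans (imp_trans (and_imp_right _ _) (and_imp_right _ _)) h4)
    (imp_of_eq (refl _))) h5
  simpa [raiseRel, fstFam, sndFam, Tm.wk_lam] using h6

end Thm
end Logic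

/-! ### Translation of constants. -/

section MapConst

variable {n : ℕ} {Γ : List (Ty n)} {α β : Ty n}

theorem Tm.mapConst_rename {K : Ty n → Type u} {K' : Ty n → Type v} (f : ∀ α, K α → K' α)
    (A : Tm K Γ α) {Θ : List (Ty n)} (ρ : ∀ α, Idx Γ α → Idx Θ α) :
    (A.rename ρ).mapConst f = (A.mapConst f).rename ρ := by
  induction A generalizing Θ <;> simp_all only [Tm.mapConst, Tm.rename]

theorem Tm.mapConst_wk {K : Ty n → Type u} {K' : Ty n → Type v} (f : ∀ α, K α → K' α)
    (A : Tm K Γ α) : (A.wk (β := β)).mapConst f = (A.mapConst f).wk := A.mapConst_rename f _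

end MapConst

/-! ### Evaluation of the context raising terms. -/

section Symbolic

variable {n : ℕ} [Fact (2 < n)] {N : ℕ} {S : Ty n → Type u} {E : Ty n → Type v}
  {Γ : List (Ty n)} {α β γ : Ty n}

namespace Thm

variable {Ax : Set (STm N S Ty.t)}

theorem uncur_app (P : Tm (SymConst N S) ((cTy ⇒ₜ α) :: (cTy ⇒ₜ cTy) :: Γ) Ty.t)
    (X : Tm (SymConst N S) Γ (ctxTy α)) :
    Thm Ax (.eq (.app (uncur (.lam (.lam P))) X)
      ((P.subst (liftSub (instSub (fstFam X)) _)).subst (instSub (sndFam X)))) := by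
  have h := beta (Ax := Ax) (.app (.app (Tm.lam (Tm.lam P)).wk (.lam (.fst (.app b1 b0))))
    (.lam (.snd (.app b1 b0)))) X
  simp only [Tm.inst, Tm.subst, Tm.wk_subst_instSub, instSub_zero, liftSub_succ,
    liftSub_zero] at h
  exact h.trans (beta₂ _ _ _)

theorem raiseRuleT_app (F : STm N S (α ⇒ₜ cTy ⇒ₜ cTy)) (A : STm N S α) (B : STm N S (ctxTy α)) :
    Thm Ax (.eq (.app (.app (raiseRuleT F) A) B) (raiseRel F A B)) := by
  have h1 : Thm Ax (.eq (.app (raiseRuleT F) A)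
      (uncur (prodPred (eqTo (.app F A)) (eqTo (.lam A.wk))))) := by
    refine (beta _ _).trans ?_
    simp [Tm.inst, uncur, prodPred, eqTo, Tm.wk_lam]
    exact refl _
  refine (congApp h1 (refl B)).trans ((uncur_app _ _).trans ?_)
  simp only [eqTo, Tm.wk_lam, raiseRel, and_subst, Tm.subst, Tm.rename, Tm.wk_app]
  refine and_congr ((beta _ _).trans ?_) ((beta _ _).trans ?_) <;>
  · simp [Tm.inst]
    exact refl _

theorem upT_app (L : STm N S (sTy ⇒ₜ α ⇒ₜ Ty.t)) (F : STm N S (α ⇒ₜ cTy ⇒ₜ cTy))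
    (W : STm N S sTy) :
    Thm Ax (.eq (.app (.app (.app upT L) F) W) (raisePred (.app L W) F)) := by
  refine trans (congApp (beta₂ _ _ _) (refl _)) (trans (beta _ _) ?_)
  -- η-expansion turns the left side into a redex at the bound variable, to be compared with the
  -- body of `raisePred`.
  refine trans (eta _).symm (congLam ?_)
  simp only [Tm.inst, uncur, Tm.wk_lam, Tm.subst, Tm.rename]
  refine (beta _ _).trans ?_
  simp only [Tm.inst, Tm.subst]
  refine (beta₂ _ _ _).trans ?_
  simp [Tm.wk_lam]
  exact refl _

end Thm

/-- Lets the rule be evaluated inside the extension once conservativity has moved its provability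
there. -/
theorem incl_raiseRuleT (F : STm N S (α ⇒ₜ cTy ⇒ₜ cTy)) :
    incl E (raiseRuleT F) = raiseRuleT (incl E F) := by
  simp [incl, raiseRuleT, uncur, Tm.mapConst, prodPred, eqTo, Tm.mapConst_wk, and, andC, tt,
    Tm.wk_lam]

end Symbolic
end TyN

/-! ### The representation of the raised language. -/

open TyN in
theorem proposition9p4 {n : ℕ} [Fact (2 < n)] {N : ℕ} {S : TyN.Ty n → Type u}
    {E : TyN.Ty n → Type v} {α : TyN.Ty n} (ℒ : TyN.ALang N S α)
    (Δ : Set (TyN.STm N (fun β => S β ⊕ E β) TyN.Ty.t))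
    (L : TyN.STm N (fun β => S β ⊕ E β) (TyN.Ty.fn TyN.sTy (TyN.Ty.fn α TyN.Ty.t)))
    (hL : TyN.PseudoCanonic E Δ L ℒ)
    (F : TyN.STm N S (TyN.Ty.fn α (TyN.Ty.fn TyN.cTy TyN.cTy))) :
    TyN.PseudoCanonic E Δ (TyN.Tm.app (TyN.Tm.app TyN.upT L) (TyN.incl E F))
      (TyN.raise ℒ F) := by
  have hrule : ∀ (A : STm N S α) (B : STm N S (ctxTy α)), (A, B) ∈ ruleOf (raiseRuleT F) ↔
      SDerives Δ (raiseRel (incl E F) (incl E A) (incl E B)) := by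
    intro A B
    refine (hL.conservative _).trans ?_
    have h : Thm {B | SymAx N (fun β => S β ⊕ E β) B}
        (.eq (incl E (.app (.app (raiseRuleT F) A) B))
          (raiseRel (incl E F) (incl E A) (incl E B))) := by
      have := Thm.raiseRuleT_app (Ax := {B | SymAx N (fun β => S β ⊕ E β) B})
        (incl E F) (incl E A) (incl E B)
      rwa [← incl_raiseRuleT] at this
    exact ⟨fun h' => h'.mpThm (.imp_of_eq h), fun h' => h'.mpThm (.imp_of_eq h.symm)⟩
  have hup : ∀ (w : List (Fin N)) (B : STm N S (ctxTy α)),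
      Thm {B | SymAx N (fun β => S β ⊕ E β) B}
        (.eq (.app (.app (.app (.app upT L) (incl E F)) (wordT w)) (incl E B))
          (raiseEx (.app L (wordT w)) (incl E F) (incl E B))) := fun w B =>
    (Thm.congApp (Thm.upT_app L (incl E F) (wordT w)) (.refl _)).trans (.raisePred_app _ _ _)
  refine { consistent := hL.consistent, conservative := hL.conservative, mem_iff := ?_,
           finite_meanings := ?_ }
  · intro w B
    constructor
    · rintro ⟨A, hA, hB⟩
      exact Derives.mpThm (Derives.mpThm
        (Derives.and_intro ((hL.mem_iff w A).1 hA) ((hrule A B).1 hB))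
        (.imp_raiseEx _ _ _ _)) (.imp_of_eq (hup w B).symm)
    · intro h
      -- Any term of type `c` serves as the context; a variable always exists, even without
      -- constants of that type. It need not be fresh for `Δ` or `B`, since the implication is a
      -- theorem for every choice.
      have h' := Derives.mpThm h ((Thm.imp_of_eq (hup w B)).imp_trans
        (Thm.raiseEx_imp _ _ _ (.fvar 0)))
      exact ⟨.snd (.app B (.fvar 0)), (hL.mem_iff _ _).2 (h'.mpThm (.and_imp_left _ _)),
        (hrule _ _).2 (h'.mpThm (.and_imp_right _ _))⟩
  · intro w
    obtain ⟨l, hl⟩ := hL.finite_meanings w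
    refine ⟨l.map (raiseT F), ?_⟩
    have hmap : (l.map (raiseT F)).map (incl E) = (l.map (incl E)).map (raiseT (incl E F)) := by
      simp [raiseT, incl, Tm.mapConst, Tm.mapConst_wk]
    rw [hmap]
    -- The equation for `L w` is only derivable from `Δ`, so it enters as the premise of a provable
    -- implication rather than through a congruence rule.
    exact Derives.mpThm hl ((Thm.raisePred_congr (incl E F) _ _).imp_trans
      (.imp_of_eq (.congEq (Thm.upT_app L (incl E F) (wordT w)).symm
        (.raisePred_bigOrEq _ _))))
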